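/- Let $m,n$ be positive integers and let $x\in\mathbb R$. For integers $k$ with $\min(m,n)\le k\le m+n$ put $$ \gamma_k^{(n,m)}=k!\,\Big(\tfrac12\Big)_{n+m-k}\sum_{j=0}^{2(n+m-k)}(-2)^j\binom{n+m+1}{2n+2m-2k-j}\binom{-m+k+j}{j}, $$ where $(z)_p=z(z+1)\cdots(z+p-1)$ (with $(z)_0=1$) is the Pochhammer symbol and, for an integer $z$, possibly negative, and an integer $j\ge 0$, $\binom zj=\frac{z(z-1)\cdots(z-j+1)}{j!}$. Then the following integral converges absolutely, and $$ \int_{-\infty}^{+\infty}\frac{n!\,m!\,2^{n+m}\,dy}{(1+y^2)^{n+1}\,(1+(x-y)^2)^{m+1}} =\frac{\pi}{2}\sum_{k=\min(m,n)}^{m+n}\frac{\gamma_k^{(n,m)}}{\big(1+\tfrac14x^2\big)^{k+1}} . $$ -/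

import Mathlib

/-- The coefficients `γ_k^{(n,m)}`, for `k ≤ n + m`:
`k! (1/2)_{n+m-k} ∑_{j=0}^{2(n+m-k)} (-2)^j C(n+m+1, 2(n+m-k)-j) C(k-m+j, j)`.
Here `(1/2)_p` is the rising factorial, and `Ring.choose` on `ℤ` is the generalized binomial
coefficient `z (z-1) ⋯ (z-j+1) / j!`, whose upper entry may be negative when `k < m`. -/
noncomputable def gammaCoeff (n m k : ℕ) : ℝ :=
  (k.factorial : ℝ) * (ascPochhammer ℝ (n + m - k)).eval (1 / 2 : ℝ) *
    ∑ j ∈ Finset.range (2 * (n + m - k) + 1),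
      (-2 : ℝ) ^ j * ((n + m + 1).choose (2 * (n + m - k) - j) : ℝ) *
        ((Ring.choose ((k : ℤ) - (m : ℤ) + (j : ℤ)) j : ℤ) : ℝ)

/-! Write φ_n for `cauchyPow n`, so the integral is the convolution F(n,m) = φ_n * φ_m. Both sides
obey the same recurrences, which determine them from F(0,0). (1) F(n+1,m) + F(n,m+1) = (2n+2m+3)
F(n,m) + x F(n,m)', since y φ_n(y) φ_m(x-y) has a derivative of integral zero. (2) F(n,m+2) = (2m+3)
F(n,m+1) - F(n,m)'', since φ_m'' = (2m+3) φ_{m+1} - φ_{m+2}. F(0,0) comes from an explicit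
antiderivative and F(0,1) from (1) and symmetry; (2) then gives every F(0,m), and (1) raises n. On
the right, with p = n+m-k, the inner sum of γ_k is the coefficient of X^(2p) in (1+X)^(n+m+1)
(1+2X)^(p-n-1). Both recurrences become identities between such coefficients: `gammaSum_succ_add`,
and `gammaSum_zero_left_recurrence` for n = 0, the only case of (2) needed. -/

section

/-! ### Generating functions for the coefficients -/

open PowerSeries

/-- The formal power series of `(1 + 2 X) ^ (-a - 1)` for an integer `a`. -/
noncomputable def negBinomialTwo (a : ℤ) : PowerSeries ℝ :=
  PowerSeries.mk fun j => (-2 : ℝ) ^ j * ((Ring.choose (a + (j : ℤ)) j : ℤ) : ℝ)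

/-- Pascal's rule, coefficient by coefficient. -/
theorem one_add_two_X_mul_negBinomialTwo (a : ℤ) :
    (1 + 2 * (X : PowerSeries ℝ)) * negBinomialTwo a = negBinomialTwo (a - 1) := by
  ext j
  rw [add_mul, one_mul, show (2 : PowerSeries ℝ) = C (2 : ℝ) from (map_ofNat C 2).symm,
    mul_assoc, map_add, coeff_C_mul]
  cases j with
  | zero => simp [negBinomialTwo]
  | succ j =>
    rw [coeff_succ_X_mul]
    simp only [negBinomialTwo, coeff_mk]
    have h := Ring.choose_succ_succ (a + (j : ℤ)) j
    have e1 : a + ((j + 1 : ℕ) : ℤ) = a + (j : ℤ) + 1 := by push_cast; ring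
    have e2 : a - 1 + ((j + 1 : ℕ) : ℤ) = a + (j : ℤ) := by push_cast; ring
    rw [e1, e2, h]
    push_cast
    ring

theorem negBinomialTwo_neg_succ (q : ℕ) :
    negBinomialTwo (-(q : ℤ) - 1) = (1 + 2 * (X : PowerSeries ℝ)) ^ q := by
  induction q with
  | zero =>
    ext j
    cases j with
    | zero => simp [negBinomialTwo]
    | succ j =>
      have e : -((0 : ℕ) : ℤ) - 1 + ((j + 1 : ℕ) : ℤ) = ((j : ℕ) : ℤ) := by push_cast; ring
      simp only [negBinomialTwo, coeff_mk, e, Ring.choose_natCast]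
      simp [coeff_one]
  | succ q ih =>
    rw [pow_succ', ← ih, one_add_two_X_mul_negBinomialTwo]
    congr 1
    push_cast
    ring

/-- The sum in `gammaCoeff`, as a function of `p = n + m - k`. -/
noncomputable def gammaSum (n m p : ℕ) : ℝ :=
  coeff (2 * p) ((1 + X) ^ (n + m + 1) * negBinomialTwo ((n : ℤ) - p))

theorem coeff_one_add_X_pow_real (N j : ℕ) :
    coeff j ((1 + X : PowerSeries ℝ) ^ N) = (N.choose j : ℝ) := by
  have h : ((1 + X : PowerSeries ℝ) ^ N) = (((1 + Polynomial.X : Polynomial ℝ) ^ N :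
      Polynomial ℝ) : PowerSeries ℝ) := by simp
  rw [h, Polynomial.coeff_coe, Polynomial.coeff_one_add_X_pow]

theorem gammaCoeff_of_add_eq {n m k p : ℕ} (h : k + p = n + m) :
    gammaCoeff n m k =
      (k.factorial : ℝ) * (ascPochhammer ℝ p).eval (1 / 2 : ℝ) * gammaSum n m p := by
  have hp : n + m - k = p := by omega
  have hk : (k : ℤ) - m = (n : ℤ) - p := by omega
  rw [gammaCoeff, gammaSum, hp, mul_comm ((1 + X : PowerSeries ℝ) ^ (n + m + 1)), coeff_mul,
    Finset.Nat.sum_antidiagonal_eq_sum_range_succ_mk]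
  congr 1
  refine Finset.sum_congr rfl fun j _ => ?_
  simp only [negBinomialTwo, coeff_mk, coeff_one_add_X_pow_real, hk]
  ring

/-- For p > n the series is a polynomial of degree at most m + p, which is below 2p when p > m. -/
theorem gammaSum_eq_zero {n m p : ℕ} (hn : n < p) (hm : m < p) : gammaSum n m p = 0 := by
  obtain ⟨q, rfl⟩ := Nat.exists_eq_add_of_lt hn
  have e : (n : ℤ) - ((n + q + 1 : ℕ) : ℤ) = -(q : ℤ) - 1 := by push_cast; ring
  rw [gammaSum, e, negBinomialTwo_neg_succ]
  have h : ((1 + X : PowerSeries ℝ) ^ (n + m + 1) * (1 + 2 * X) ^ q) =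
      (((1 + Polynomial.X) ^ (n + m + 1) * (1 + 2 * Polynomial.X) ^ q : Polynomial ℝ) :
        PowerSeries ℝ) := by
    have h2 : ((2 : Polynomial ℝ) : PowerSeries ℝ) = 2 := by
      rw [← map_ofNat Polynomial.C 2, Polynomial.coe_C, map_ofNat]
    simp [h2]
  rw [h, Polynomial.coeff_coe]
  apply Polynomial.coeff_eq_zero_of_natDegree_lt
  have hd : ((1 + Polynomial.X) ^ (n + m + 1) * (1 + 2 * Polynomial.X) ^ q :
      Polynomial ℝ).natDegree ≤ (n + m + 1) + q := by
    compute_degree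
  omega

theorem gammaSum_zero_right (n m : ℕ) : gammaSum n m 0 = 1 := by
  simp [gammaSum, negBinomialTwo]

/-- With Q = (1+2X)^(p-n-1), this comes from 1 + (1+2X) = 2(1+X) and (1+X)² = X² + (1+2X); the
factor X² turns index 2(p+1) into 2p. -/
theorem gammaSum_succ_add (n m p : ℕ) :
    gammaSum (n + 1) m (p + 1) + gammaSum n (m + 1) (p + 1) =
      2 * gammaSum n m p + 2 * gammaSum n m (p + 1) := by
  simp only [gammaSum]
  have e1 : ((n + 1 : ℕ) : ℤ) - ((p + 1 : ℕ) : ℤ) = (n : ℤ) - p := by push_cast; ring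
  have e2 : (n : ℤ) - ((p + 1 : ℕ) : ℤ) = (n : ℤ) - p - 1 := by push_cast; ring
  rw [e1, e2, ← one_add_two_X_mul_negBinomialTwo]
  set Q := negBinomialTwo ((n : ℤ) - p)
  have h0 : coeff (2 * p) ((1 + X : PowerSeries ℝ) ^ (n + m + 1) * Q) =
      coeff (2 * (p + 1)) (X ^ 2 * ((1 + X : PowerSeries ℝ) ^ (n + m + 1) * Q)) := by
    rw [mul_add, mul_one, coeff_X_pow_mul]
  have h2 : ∀ f : PowerSeries ℝ, ∀ j, 2 * coeff j f = coeff j (2 * f) := by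
    intro f j
    rw [show (2 : PowerSeries ℝ) = C (2 : ℝ) from (map_ofNat C 2).symm, coeff_C_mul]
  rw [h0, h2, h2, ← map_add, ← map_add]
  congr 1
  ring

theorem gammaSum_zero_left_succ (m q : ℕ) :
    gammaSum 0 m (q + 1) = coeff (2 * q + 2) ((1 + X) ^ (m + 1) * (1 + 2 * X) ^ q) := by
  have e : ((0 : ℕ) : ℤ) - ((q + 1 : ℕ) : ℤ) = -(q : ℤ) - 1 := by push_cast; ring
  rw [gammaSum, e, negBinomialTwo_neg_succ, zero_add, mul_add, mul_one]

theorem coeff_X_mul_derivative (f : PowerSeries ℝ) (j : ℕ) :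
    coeff j (X * derivative ℝ f) = j * coeff j f := by
  cases j with
  | zero => simp
  | succ j => rw [coeff_succ_X_mul, coeff_derivative]; push_cast; ring

theorem gammaSum_zero_left_recurrence (m p : ℕ) :
    (2 * (p : ℝ) + 1) * (gammaSum 0 (m + 2) (p + 1) - gammaSum 0 m (p + 1)) =
      2 * (2 * m + 3) * gammaSum 0 (m + 1) p - (2 * m + 3 - 2 * p) * gammaSum 0 m p := by
  cases p with
  | zero =>
    rw [gammaSum_zero_left_succ, gammaSum_zero_left_succ, gammaSum_zero_right,
      gammaSum_zero_right]
    simp only [pow_zero, mul_one, coeff_one_add_X_pow_real, mul_zero, zero_add]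
    rw [Nat.cast_choose_two, Nat.cast_choose_two]
    push_cast
    ring
  | succ q =>
    simp only [gammaSum_zero_left_succ]
    set Y : PowerSeries ℝ := (1 + X) ^ (m + 1) * (1 + 2 * X) ^ q with hY
    set H : PowerSeries ℝ := (2 + X) * (1 + 2 * X) * Y with hH
    set K : PowerSeries ℝ := (1 + X) ^ (m + 2) * (1 + 2 * X) ^ (q + 1) with hK
    have h2 : (2 : PowerSeries ℝ) = C (2 : ℝ) := (map_ofNat C 2).symm
    have hl : coeff (2 * (q + 1) + 2) ((1 + X) ^ (m + 2 + 1) * (1 + 2 * X) ^ (q + 1)) -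
        coeff (2 * (q + 1) + 2) ((1 + X) ^ (m + 1) * (1 + 2 * X) ^ (q + 1)) =
        coeff (2 * q + 3) H := by
      rw [← map_sub, show 2 * (q + 1) + 2 = 2 * q + 3 + 1 by ring, ← coeff_succ_X_mul _ H]
      congr 1
      rw [hH, hY]
      ring
    have hdK : derivative ℝ K =
        (C ((m : ℝ) + 2) * (1 + 2 * X) + C (2 * ((q : ℝ) + 1)) * (1 + X)) * Y := by
      have d1 : derivative ℝ (1 + X : PowerSeries ℝ) = 1 := by simp
      have d2 : derivative ℝ (1 + 2 * X : PowerSeries ℝ) = 2 := by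
        rw [h2]; simp [Derivation.leibniz]
      rw [hK, Derivation.leibniz, Derivation.leibniz_pow, Derivation.leibniz_pow, d1, d2, hY]
      simp only [smul_eq_mul, nsmul_eq_mul, map_add, map_mul, map_natCast, map_ofNat, map_one]
      push_cast
      ring
    -- Telescoping certificate: X K' - (2q+3) K has no term of degree 2q+3, and `key` shows that the
    -- recurrence is -2 times that coefficient.
    have hcert := coeff_X_mul_derivative K (2 * q + 3)
    rw [hl]
    have e1 : coeff (2 * q + 2) ((1 + X : PowerSeries ℝ) ^ (m + 1 + 1) * (1 + 2 * X) ^ q) =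
        coeff (2 * q + 3) (X * ((1 + X) * Y)) := by
      rw [coeff_succ_X_mul, hY]; congr 1; ring
    have e2 : coeff (2 * q + 2) Y = coeff (2 * q + 3) (X * Y) := (coeff_succ_X_mul _ _).symm
    rw [e1, e2]
    rw [hdK] at hcert
    have key : C (2 * ((q : ℝ) + 1) + 1) * H
        - (C (2 * (2 * (m : ℝ) + 3)) * (X * ((1 + X) * Y))
          - C (2 * (m : ℝ) + 3 - 2 * (q + 1)) * (X * Y))
        = C (-2 : ℝ) * (X * ((C ((m : ℝ) + 2) * (1 + 2 * X)
          + C (2 * ((q : ℝ) + 1)) * (1 + X)) * Y)) - C (-2 * (2 * (q : ℝ) + 3)) * K := by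
      have hKY : K = (1 + X) * (1 + 2 * X) * Y := by rw [hK, hY]; ring
      rw [hKY, hH]
      simp only [map_add, map_mul, map_sub, map_neg, map_natCast, map_ofNat, map_one]
      ring
    have := congrArg (coeff (2 * q + 3)) key
    rw [map_sub (coeff _), map_sub (coeff _), map_sub (coeff _)] at this
    simp only [coeff_C_mul] at this
    rw [hcert] at this
    push_cast at this ⊢
    linear_combination this

end

/-! ### Convolutions of the kernels -/

section

open MeasureTheory

/-- The kernel `n! 2ⁿ / (1 + y²)ⁿ⁺¹`. -/
noncomputable def cauchyPow (n : ℕ) (y : ℝ) : ℝ :=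
  (n.factorial : ℝ) * 2 ^ n / (1 + y ^ 2) ^ (n + 1)

theorem continuous_cauchyPow (n : ℕ) : Continuous (cauchyPow n) := by
  unfold cauchyPow
  exact continuous_const.div (by fun_prop) fun y => by positivity

theorem mul_cauchyPow_succ (n : ℕ) (y : ℝ) :
    (1 + y ^ 2) * cauchyPow (n + 1) y = 2 * (n + 1) * cauchyPow n y := by
  have : (1 + y ^ 2) ≠ 0 := by positivity
  simp only [cauchyPow, Nat.factorial_succ]
  push_cast
  field_simp
  ring

/-- The normalisation n! 2ⁿ absorbs the constant 2(n+1) that differentiation produces. -/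
theorem hasDerivAt_cauchyPow (n : ℕ) (y : ℝ) :
    HasDerivAt (cauchyPow n) (-y * cauchyPow (n + 1) y) y := by
  have h0 : (1 + y ^ 2) ≠ 0 := by positivity
  have h1 : HasDerivAt (fun y : ℝ => (1 + y ^ 2) ^ (n + 1)) _ y :=
    (((hasDerivAt_id y).pow 2).const_add 1).pow (n + 1)
  have h2 := (hasDerivAt_const y ((n.factorial : ℝ) * 2 ^ n)).div h1 (pow_ne_zero _ h0)
  refine h2.congr_deriv ?_
  simp only [cauchyPow, Nat.factorial_succ]
  push_cast
  simp
  field_simp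
  ring

theorem abs_cauchyPow_le (n : ℕ) (y : ℝ) :
    |cauchyPow n y| ≤ (n.factorial : ℝ) * 2 ^ n * (1 + y ^ 2)⁻¹ := by
  have h0 : 1 ≤ 1 + y ^ 2 := by nlinarith [sq_nonneg y]
  rw [cauchyPow, abs_of_nonneg (by positivity), div_eq_mul_inv]
  gcongr
  exact le_self_pow₀ h0 (by omega)

theorem abs_cauchyPow_le_const (n : ℕ) (y : ℝ) :
    |cauchyPow n y| ≤ (n.factorial : ℝ) * 2 ^ n := by
  refine (abs_cauchyPow_le n y).trans (mul_le_of_le_one_right (by positivity) ?_)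
  exact inv_le_one_of_one_le₀ (by nlinarith [sq_nonneg y])

theorem integrable_cauchyPow (n : ℕ) : Integrable (cauchyPow n) :=
  (integrable_inv_one_add_sq.const_mul ((n.factorial : ℝ) * 2 ^ n)).mono'
    (continuous_cauchyPow n).aestronglyMeasurable
    (Filter.Eventually.of_forall fun y => abs_cauchyPow_le n y)

theorem abs_mul_cauchyPow_le (n : ℕ) (y : ℝ) :
    |y * cauchyPow n y| ≤ (n.factorial : ℝ) * 2 ^ n := by
  have h1 : |y| ≤ 1 + y ^ 2 := by
    rw [abs_le]; constructor <;> nlinarith [sq_nonneg (y + 1), sq_nonneg (y - 1)]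
  calc |y * cauchyPow n y| = |y| * |cauchyPow n y| := abs_mul _ _
    _ ≤ (1 + y ^ 2) * ((n.factorial : ℝ) * 2 ^ n * (1 + y ^ 2)⁻¹) := by
        gcongr; exact abs_cauchyPow_le n y
    _ = _ := by field_simp

theorem hasDerivAt_neg_mul_cauchyPow_succ (n : ℕ) (y : ℝ) :
    HasDerivAt (fun y => -y * cauchyPow (n + 1) y)
      ((2 * n + 3) * cauchyPow (n + 1) y - cauchyPow (n + 2) y) y := by
  refine ((hasDerivAt_id y).neg.mul (hasDerivAt_cauchyPow (n + 1) y)).congr_deriv ?_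
  have h := mul_cauchyPow_succ (n + 1) y
  push_cast at h
  simp
  linear_combination h

theorem integrable_mul_comp_sub {φ g : ℝ → ℝ} (hφ : Integrable φ) (hg : Continuous g) {C : ℝ}
    (hC : ∀ y, |g y| ≤ C) (x : ℝ) : Integrable fun y => φ y * g (x - y) :=
  hφ.mul_bdd (c := C) (by fun_prop : Continuous fun y => g (x - y)).aestronglyMeasurable
    (Filter.Eventually.of_forall fun y => hC _)

theorem hasDerivAt_integral_mul_comp_sub {φ g g' : ℝ → ℝ} (hφ : Integrable φ)
    (hg : ∀ y, HasDerivAt g (g' y) y) (hg' : Continuous g') {C C' : ℝ}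
    (hC : ∀ y, |g y| ≤ C) (hC' : ∀ y, |g' y| ≤ C') (x : ℝ) :
    HasDerivAt (fun x => ∫ y, φ y * g (x - y)) (∫ y, φ y * g' (x - y)) x := by
  have hgc : Continuous g := continuous_iff_continuousAt.2 fun y => (hg y).continuousAt
  refine (hasDerivAt_integral_of_dominated_loc_of_deriv_le (bound := fun y => |φ y| * C')
    (F := fun x y => φ y * g (x - y)) (F' := fun x y => φ y * g' (x - y))
    (s := Set.univ) Filter.univ_mem ?_ ?_ ?_ ?_ ?_ ?_).2
  · exact Filter.Eventually.of_forall fun x =>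
      (integrable_mul_comp_sub hφ hgc hC x).aestronglyMeasurable
  · exact integrable_mul_comp_sub hφ hgc hC x
  · exact (integrable_mul_comp_sub hφ hg' hC' x).aestronglyMeasurable
  · refine Filter.Eventually.of_forall fun y x _ => ?_
    rw [norm_mul]
    exact mul_le_mul_of_nonneg_left (hC' _) (norm_nonneg _)
  · exact hφ.abs.mul_const C'
  · refine Filter.Eventually.of_forall fun y x _ => ?_
    exact ((hg (x - y)).comp_sub_const x y).const_mul (φ y)

/-- The convolution of two kernels `cauchyPow`. -/
noncomputable def cauchyConv (n m : ℕ) (x : ℝ) : ℝ := ∫ y, cauchyPow n y * cauchyPow m (x - y)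

theorem integrable_cauchyPow_mul (n m : ℕ) (x : ℝ) :
    Integrable fun y => cauchyPow n y * cauchyPow m (x - y) :=
  integrable_mul_comp_sub (integrable_cauchyPow n) (continuous_cauchyPow m)
    (abs_cauchyPow_le_const m) x

theorem cauchyConv_comm (n m : ℕ) (x : ℝ) : cauchyConv n m x = cauchyConv m n x := by
  rw [cauchyConv, cauchyConv,
    ← integral_sub_left_eq_self (fun y => cauchyPow m y * cauchyPow n (x - y)) volume x]
  simp [mul_comm]

theorem continuous_mul_cauchyPow (n : ℕ) : Continuous fun y => -y * cauchyPow n y :=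
  continuous_neg.mul (continuous_cauchyPow n)

theorem abs_neg_mul_cauchyPow_le (n : ℕ) (y : ℝ) :
    |-y * cauchyPow n y| ≤ (n.factorial : ℝ) * 2 ^ n := by
  rw [neg_mul, abs_neg]; exact abs_mul_cauchyPow_le n y

theorem hasDerivAt_cauchyConv (n m : ℕ) (x : ℝ) :
    HasDerivAt (cauchyConv n m)
      (∫ y, cauchyPow n y * (-(x - y) * cauchyPow (m + 1) (x - y))) x :=
  hasDerivAt_integral_mul_comp_sub (integrable_cauchyPow n) (hasDerivAt_cauchyPow m)
    (continuous_mul_cauchyPow (m + 1)) (abs_cauchyPow_le_const m)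
    (abs_neg_mul_cauchyPow_le (m + 1)) x

theorem hasDerivAt_deriv_cauchyConv (n m : ℕ) (x : ℝ) :
    HasDerivAt (deriv (cauchyConv n m))
      ((2 * m + 3) * cauchyConv n (m + 1) x - cauchyConv n (m + 2) x) x := by
  rw [show deriv (cauchyConv n m) = _ from funext fun x => (hasDerivAt_cauchyConv n m x).deriv]
  have h := hasDerivAt_integral_mul_comp_sub (integrable_cauchyPow n)
    (hasDerivAt_neg_mul_cauchyPow_succ m)
    (((continuous_cauchyPow (m + 1)).const_mul _).sub (continuous_cauchyPow (m + 2)))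
    (abs_neg_mul_cauchyPow_le (m + 1))
    (fun y => (abs_sub _ _).trans (add_le_add (abs_mul _ _).le le_rfl) |>.trans
      (add_le_add (mul_le_mul_of_nonneg_left (abs_cauchyPow_le_const (m + 1) y)
        (abs_nonneg _)) (abs_cauchyPow_le_const (m + 2) y))) x
  refine h.congr_deriv ?_
  rw [cauchyConv, cauchyConv, ← integral_const_mul, ← integral_sub
    ((integrable_cauchyPow_mul n (m + 1) x).const_mul _) (integrable_cauchyPow_mul n (m + 2) x)]
  congr 1
  ext y
  ring

theorem cauchyConv_succ_add (n m : ℕ) (x : ℝ) :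
    cauchyConv (n + 1) m x + cauchyConv n (m + 1) x =
      (2 * n + 2 * m + 3) * cauchyConv n m x + x * deriv (cauchyConv n m) x := by
  rw [(hasDerivAt_cauchyConv n m x).deriv]
  set I : ℝ → ℝ := fun y => cauchyPow n y * (-(x - y) * cauchyPow (m + 1) (x - y)) with hI
  have hIint : Integrable I := integrable_mul_comp_sub (integrable_cauchyPow n)
    (continuous_mul_cauchyPow (m + 1)) (abs_neg_mul_cauchyPow_le (m + 1)) x
  have h1 := integrable_cauchyPow_mul (n + 1) m x
  have h2 := integrable_cauchyPow_mul n (m + 1) x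
  have h3 := integrable_cauchyPow_mul n m x
  set D : ℝ → ℝ := fun y => cauchyPow (n + 1) y * cauchyPow m (x - y)
    + cauchyPow n y * cauchyPow (m + 1) (x - y)
    - (2 * n + 2 * m + 3) * (cauchyPow n y * cauchyPow m (x - y)) - x * I y with hD
  have hDint : Integrable D := ((h1.add h2).sub (h3.const_mul _)).sub (hIint.const_mul x)
  have hderiv : ∀ y, HasDerivAt (fun y => y * (cauchyPow n y * cauchyPow m (x - y))) (D y) y := by
    intro y
    have d1 := hasDerivAt_cauchyPow n y
    have d2 : HasDerivAt (fun y => cauchyPow m (x - y))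
        (-(-(x - y) * cauchyPow (m + 1) (x - y))) y :=
      (hasDerivAt_cauchyPow m (x - y)).comp_const_sub x y
    refine ((hasDerivAt_id y).mul (d1.mul d2)).congr_deriv ?_
    have r1 := mul_cauchyPow_succ n y
    have r2 := mul_cauchyPow_succ m (x - y)
    simp only [hD, hI, id, Pi.mul_apply]
    linear_combination (-cauchyPow m (x - y)) * r1 - cauchyPow n y * r2
  have hzero : ∫ y, D y = 0 := by
    refine integral_eq_zero_of_hasDerivAt_of_integrable hderiv hDint ?_
    -- The primitive is integrable: y φ_n(y) is bounded and φ_m(x-y) is integrable.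
    have hb := ((integrable_cauchyPow m).comp_sub_left x).bdd_mul (c := (n.factorial : ℝ) * 2 ^ n)
      (continuous_id.mul (continuous_cauchyPow n)).aestronglyMeasurable
      (Filter.Eventually.of_forall fun y => abs_mul_cauchyPow_le n y)
    simpa [mul_assoc] using hb
  have hsplit : ∫ y, D y = cauchyConv (n + 1) m x + cauchyConv n (m + 1) x
      - (2 * n + 2 * m + 3) * cauchyConv n m x - x * ∫ y, I y := by
    refine (integral_sub ((h1.add h2).sub (h3.const_mul _)) (hIint.const_mul x)).trans ?_
    rw [integral_const_mul]
    congr 1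
    refine (integral_sub (h1.add h2) (h3.const_mul _)).trans ?_
    rw [integral_const_mul]
    congr 1
    exact integral_add h1 h2
  linarith

theorem tendsto_log_sub_log_one_add_sq (x : ℝ) {l : Filter ℝ}
    (hl : Filter.Tendsto (fun y : ℝ => y⁻¹) l (nhds 0)) (hne : ∀ᶠ y in l, y ≠ 0) :
    Filter.Tendsto (fun y => Real.log (1 + y ^ 2) - Real.log (1 + (x - y) ^ 2)) l (nhds 0) := by
  -- The substitution z = 1/y cancels log y² and leaves a function continuous at z = 0.
  set h : ℝ → ℝ := fun z => Real.log (z ^ 2 + 1) - Real.log (z ^ 2 + (x * z - 1) ^ 2) with hh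
  have hc : ContinuousAt h 0 := by
    refine ContinuousAt.sub ?_ ?_ <;> refine ContinuousAt.log (by fun_prop) (by norm_num)
  have h0 : h 0 = 0 := by simp [hh]
  have ht := hc.tendsto.comp hl
  rw [h0] at ht
  refine ht.congr' ?_
  filter_upwards [hne] with y hy
  have hv : 1 + (x - y) ^ 2 ≠ 0 := by positivity
  have hu : 1 + y ^ 2 ≠ 0 := by positivity
  have e1 : y⁻¹ ^ 2 + 1 = (1 + y ^ 2) / y ^ 2 := by field_simp
  have e2 : y⁻¹ ^ 2 + (x * y⁻¹ - 1) ^ 2 = (1 + (x - y) ^ 2) / y ^ 2 := by field_simp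
  simp only [hh, Function.comp_apply]
  rw [e1, e2, Real.log_div hu (by positivity), Real.log_div hv (by positivity)]
  ring

theorem cauchyConv_zero_zero (x : ℝ) : cauchyConv 0 0 x = Real.pi / 2 / (1 + x ^ 2 / 4) := by
  have hne : ∀ x : ℝ, x ≠ 0 → cauchyConv 0 0 x = Real.pi / 2 / (1 + x ^ 2 / 4) := by
    intro x hx
    have hderiv : ∀ y, HasDerivAt (fun y => Real.log (1 + y ^ 2) - Real.log (1 + (x - y) ^ 2)
        + (x * Real.arctan y + x * Real.arctan (y - x)))
        (x * (x ^ 2 + 4) * (cauchyPow 0 y * cauchyPow 0 (x - y))) y := by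
      intro y
      have hu : 1 + y ^ 2 ≠ 0 := by positivity
      have hv : 1 + (x - y) ^ 2 ≠ 0 := by positivity
      have d1 := (((hasDerivAt_id y).pow 2).const_add 1).log hu
      have d2 := ((((hasDerivAt_id y).const_sub x).pow 2).const_add 1).log hv
      have d3 := (Real.hasDerivAt_arctan y).const_mul x
      have d4 := (((hasDerivAt_id y).sub_const x).arctan).const_mul x
      refine ((d1.sub d2).add (d3.add d4)).congr_deriv ?_
      simp only [cauchyPow, id]
      have hvv : 1 + (y - x) ^ 2 = 1 + (x - y) ^ 2 := by ring
      rw [hvv]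
      simp
      field_simp
      ring
    have hbot : Filter.Tendsto (fun y => Real.log (1 + y ^ 2) - Real.log (1 + (x - y) ^ 2)
        + (x * Real.arctan y + x * Real.arctan (y - x))) Filter.atBot
        (nhds (0 + (x * (-(Real.pi / 2)) + x * (-(Real.pi / 2))))) := by
      have ha := Real.tendsto_arctan_atBot.mono_right nhdsWithin_le_nhds
      exact (tendsto_log_sub_log_one_add_sq x tendsto_inv_atBot_zero
        (Filter.eventually_ne_atBot 0)).add ((ha.const_mul x).add
        ((ha.comp (Filter.tendsto_atBot_add_const_right _ (-x) Filter.tendsto_id)).const_mul x))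
    have htop : Filter.Tendsto (fun y => Real.log (1 + y ^ 2) - Real.log (1 + (x - y) ^ 2)
        + (x * Real.arctan y + x * Real.arctan (y - x))) Filter.atTop
        (nhds (0 + (x * (Real.pi / 2) + x * (Real.pi / 2)))) := by
      have ha := Real.tendsto_arctan_atTop.mono_right nhdsWithin_le_nhds
      exact (tendsto_log_sub_log_one_add_sq x tendsto_inv_atTop_zero
        (Filter.eventually_ne_atTop 0)).add ((ha.const_mul x).add
        ((ha.comp (Filter.tendsto_atTop_add_const_right _ (-x) Filter.tendsto_id)).const_mul x))
    have h := integral_of_hasDerivAt_of_tendsto hderiv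
      ((integrable_cauchyPow_mul 0 0 x).const_mul _) hbot htop
    rw [integral_const_mul] at h
    change x * (x ^ 2 + 4) * cauchyConv 0 0 x = _ at h
    have h4 : x ^ 2 + 4 ≠ 0 := by positivity
    have h5 : 1 + x ^ 2 / 4 ≠ 0 := by positivity
    apply mul_left_cancel₀ (mul_ne_zero hx h4)
    rw [h]
    field_simp
    ring
  -- The antiderivative carries a factor x, so x = 0 is reached by continuity.
  have hcl : Continuous (cauchyConv 0 0) :=
    continuous_iff_continuousAt.2 fun x => (hasDerivAt_cauchyConv 0 0 x).continuousAt
  have hcr : Continuous fun x : ℝ => Real.pi / 2 / (1 + x ^ 2 / 4) :=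
    continuous_const.div (by fun_prop) fun x => by positivity
  have hd : Dense ({0}ᶜ : Set ℝ) := dense_compl_singleton 0
  exact congrFun (hcl.ext_on hd hcr fun x hx => hne x hx) x

end

/-! ### Recurrences for sums of powers of `1 + x² / 4` -/

/-- The basic function `(1 + x² / 4)⁻⁽ᵏ⁺¹⁾`. -/
noncomputable def quarterPow (k : ℕ) (x : ℝ) : ℝ := ((1 + x ^ 2 / 4) ^ (k + 1))⁻¹

theorem quarterPow_succ (k : ℕ) (x : ℝ) :
    (1 + x ^ 2 / 4) * quarterPow (k + 1) x = quarterPow k x := by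
  have : 1 + x ^ 2 / 4 ≠ 0 := by positivity
  rw [quarterPow, quarterPow, pow_succ _ (k + 1), mul_inv]
  field_simp

theorem hasDerivAt_quarterPow (k : ℕ) (x : ℝ) :
    HasDerivAt (quarterPow k) (-(k + 1) * (x / 2 * quarterPow (k + 1) x)) x := by
  have h0 : 1 + x ^ 2 / 4 ≠ 0 := by positivity
  have h := (((((hasDerivAt_id x).pow 2).div_const 4).const_add 1).pow (k + 1)).inv
    (pow_ne_zero _ h0)
  refine h.congr_deriv ?_
  simp only [quarterPow, id]
  simp
  field_simp
  ring

theorem hasDerivAt_deriv_quarterPow (k : ℕ) (x : ℝ) :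
    HasDerivAt (fun x => -(k + 1) * (x / 2 * quarterPow (k + 1) x))
      ((k + 1) * ((k + 3 / 2) * quarterPow (k + 1) x - (k + 2) * quarterPow (k + 2) x)) x := by
  have h := (((hasDerivAt_id x).div_const 2).mul (hasDerivAt_quarterPow (k + 1) x)).const_mul
    (-((k : ℝ) + 1))
  refine h.congr_deriv ?_
  have := quarterPow_succ (k + 1) x
  simp only [id]
  push_cast
  linear_combination ((k : ℝ) + 1) * (k + 2) * this

/-- The combination `∑_{k + p = N} k! (1/2)_p c_p (1 + x² / 4)⁻⁽ᵏ⁺¹⁾`. -/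
noncomputable def quarterSum (N : ℕ) (c : ℕ → ℝ) (x : ℝ) : ℝ :=
  ∑ q ∈ Finset.HasAntidiagonal.antidiagonal N, (q.1.factorial : ℝ) * (ascPochhammer ℝ q.2).eval (1 / 2 : ℝ) *
    c q.2 * quarterPow q.1 x

theorem deriv_quarterSum (N : ℕ) (c : ℕ → ℝ) :
    deriv (quarterSum N c) = fun x => ∑ q ∈ Finset.HasAntidiagonal.antidiagonal N, (q.1.factorial : ℝ) *
      (ascPochhammer ℝ q.2).eval (1 / 2 : ℝ) * c q.2 *
        (-(q.1 + 1) * (x / 2 * quarterPow (q.1 + 1) x)) := by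
  funext x
  refine HasDerivAt.deriv ?_
  exact HasDerivAt.fun_sum fun q _ => (hasDerivAt_quarterPow q.1 x).const_mul _

theorem deriv_deriv_quarterSum (N : ℕ) (c : ℕ → ℝ) (x : ℝ) :
    deriv (deriv (quarterSum N c)) x = ∑ q ∈ Finset.HasAntidiagonal.antidiagonal N, (q.1.factorial : ℝ) *
      (ascPochhammer ℝ q.2).eval (1 / 2 : ℝ) * c q.2 *
        ((q.1 + 1) * ((q.1 + 3 / 2) * quarterPow (q.1 + 1) x
          - (q.1 + 2) * quarterPow (q.1 + 2) x)) := by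
  rw [deriv_quarterSum]
  refine HasDerivAt.deriv ?_
  exact HasDerivAt.fun_sum fun q _ => (hasDerivAt_deriv_quarterPow q.1 x).const_mul _

theorem ascPochhammer_succ_eval_half (p : ℕ) :
    (ascPochhammer ℝ (p + 1)).eval (1 / 2 : ℝ) =
      (ascPochhammer ℝ p).eval (1 / 2 : ℝ) * (p + 1 / 2) := by
  rw [ascPochhammer_succ_eval, add_comm (1 / 2 : ℝ)]

/-- With Q_k = `quarterPow k` and k + p = N, (2N+3) Q_k + x Q_k' = (2p+1) Q_k + 2(k+1) Q_{k+1}. The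
weights k! and (1/2)_p absorb these factors: one term raises k, the other raises p. -/
theorem quarterSum_first_order (N : ℕ) (c d : ℕ → ℝ) (hc : c (N + 1) = 0)
    (h0 : d 0 = 2 * c 0) (hd : ∀ p, d (p + 1) = 2 * c p + 2 * c (p + 1)) (x : ℝ) :
    quarterSum (N + 1) d x =
      (2 * N + 3) * quarterSum N c x + x * deriv (quarterSum N c) x := by
  have hsplit : quarterSum (N + 1) d x = quarterSum (N + 1) (fun p => 2 * c p) x
      + quarterSum (N + 1) (fun p => d p - 2 * c p) x := by
    simp only [quarterSum, ← Finset.sum_add_distrib]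
    exact Finset.sum_congr rfl fun q _ => by ring
  have h1 : quarterSum (N + 1) (fun p => 2 * c p) x = ∑ q ∈ Finset.HasAntidiagonal.antidiagonal N,
      (q.1.factorial : ℝ) * (ascPochhammer ℝ q.2).eval (1 / 2 : ℝ) * c q.2 *
        (2 * (q.1 + 1) * quarterPow (q.1 + 1) x) := by
    rw [quarterSum, Finset.Nat.sum_antidiagonal_succ]
    simp only [hc, mul_zero, zero_mul, zero_add]
    refine Finset.sum_congr rfl fun q _ => ?_
    rw [Nat.factorial_succ]
    push_cast
    ring
  have h2 : quarterSum (N + 1) (fun p => d p - 2 * c p) x = ∑ q ∈ Finset.HasAntidiagonal.antidiagonal N,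
      (q.1.factorial : ℝ) * (ascPochhammer ℝ q.2).eval (1 / 2 : ℝ) * c q.2 *
        ((2 * q.2 + 1) * quarterPow q.1 x) := by
    rw [quarterSum, Finset.Nat.sum_antidiagonal_succ']
    simp only [h0, sub_self, mul_zero, zero_mul, zero_add]
    refine Finset.sum_congr rfl fun q _ => ?_
    rw [ascPochhammer_succ_eval_half, hd]
    ring
  rw [hsplit, h1, h2, deriv_quarterSum, quarterSum, Finset.mul_sum, Finset.mul_sum,
    ← Finset.sum_add_distrib, ← Finset.sum_add_distrib]
  refine Finset.sum_congr rfl fun q hq => ?_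
  have hN : (N : ℝ) = q.1 + q.2 := by
    rw [← Finset.HasAntidiagonal.mem_antidiagonal.1 hq]; push_cast; ring
  have hs := quarterPow_succ q.1 x
  rw [hN]
  linear_combination (2 * ((q.1 : ℝ) + 1) * ((q.1.factorial : ℝ) *
    (ascPochhammer ℝ q.2).eval (1 / 2 : ℝ) * c q.2)) * hs

theorem quarterSum_second_order (m : ℕ) (a b c : ℕ → ℝ) (h0 : c 0 = a 0)
    (ha : ∀ p, m < p → a p = 0)
    (hrec : ∀ p : ℕ, (2 * (p : ℝ) + 1) * (c (p + 1) - a (p + 1)) =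
      2 * (2 * m + 3) * b p - (2 * m + 3 - 2 * p) * a p) (x : ℝ) :
    quarterSum (m + 2) c x =
      (2 * m + 3) * quarterSum (m + 1) b x - deriv (deriv (quarterSum m a)) x := by
  have hsplit : quarterSum (m + 2) c x = quarterSum (m + 2) a x
      + quarterSum (m + 2) (fun p => c p - a p) x := by
    simp only [quarterSum, ← Finset.sum_add_distrib]
    exact Finset.sum_congr rfl fun q _ => by ring
  have h1 : quarterSum (m + 2) a x = ∑ q ∈ Finset.HasAntidiagonal.antidiagonal m,
      (q.1.factorial : ℝ) * (ascPochhammer ℝ q.2).eval (1 / 2 : ℝ) * a q.2 *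
        ((q.1 + 1) * (q.1 + 2) * quarterPow (q.1 + 2) x) := by
    rw [quarterSum, Finset.Nat.sum_antidiagonal_succ, Finset.Nat.sum_antidiagonal_succ]
    simp only [ha (m + 1) (by omega), ha (m + 1 + 1) (by omega), mul_zero, zero_mul, zero_add]
    refine Finset.sum_congr rfl fun q _ => ?_
    rw [Nat.factorial_succ, Nat.factorial_succ]
    push_cast
    ring
  have h2 : quarterSum (m + 2) (fun p => c p - a p) x =
      (2 * m + 3) * quarterSum (m + 1) b x - ∑ q ∈ Finset.HasAntidiagonal.antidiagonal m,
      (q.1.factorial : ℝ) * (ascPochhammer ℝ q.2).eval (1 / 2 : ℝ) * a q.2 *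
        ((q.1 + 1) * (q.1 + 3 / 2) * quarterPow (q.1 + 1) x) := by
    have h3 : ∑ q ∈ Finset.HasAntidiagonal.antidiagonal m,
        (q.1.factorial : ℝ) * (ascPochhammer ℝ q.2).eval (1 / 2 : ℝ) * a q.2 *
          ((q.1 + 1) * (q.1 + 3 / 2) * quarterPow (q.1 + 1) x) =
        ∑ q ∈ Finset.HasAntidiagonal.antidiagonal (m + 1),
        (q.1.factorial : ℝ) * (ascPochhammer ℝ q.2).eval (1 / 2 : ℝ) * a q.2 *
          ((q.1 + 1 / 2) * quarterPow q.1 x) := by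
      rw [Finset.Nat.sum_antidiagonal_succ]
      simp only [ha (m + 1) (by omega), mul_zero, zero_mul, zero_add]
      refine Finset.sum_congr rfl fun q _ => ?_
      rw [Nat.factorial_succ]
      push_cast
      ring
    rw [h3, quarterSum, Finset.Nat.sum_antidiagonal_succ', quarterSum, Finset.mul_sum,
      ← Finset.sum_sub_distrib]
    simp only [h0, sub_self, mul_zero, zero_mul, zero_add]
    refine Finset.sum_congr rfl fun q hq => ?_
    -- Here k + 1/2 = (2m+3-2p)/2, so the coefficients match by half of `hrec`.
    have hN : (m : ℝ) + 1 = q.1 + q.2 := by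
      exact_mod_cast (Finset.HasAntidiagonal.mem_antidiagonal.1 hq).symm
    rw [ascPochhammer_succ_eval_half]
    have hq1 : (q.1 : ℝ) = m + 1 - q.2 := by linarith
    rw [hq1]
    linear_combination ((q.1.factorial : ℝ) * (ascPochhammer ℝ q.2).eval (1 / 2 : ℝ) *
      quarterPow q.1 x / 2) * hrec q.2
  rw [hsplit, h1, h2, deriv_deriv_quarterSum, add_comm, sub_add, ← Finset.sum_sub_distrib]
  congr 1
  exact Finset.sum_congr rfl fun q _ => by ring

theorem quarterSum_add (N : ℕ) (c d : ℕ → ℝ) (x : ℝ) :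
    quarterSum N (fun p => c p + d p) x = quarterSum N c x + quarterSum N d x := by
  simp only [quarterSum, ← Finset.sum_add_distrib]
  exact Finset.sum_congr rfl fun q _ => by ring

/-! ### Induction on the two indices -/

theorem quarterSum_gammaSum_succ_add (n m : ℕ) (x : ℝ) :
    quarterSum (n + 1 + m) (gammaSum (n + 1) m) x + quarterSum (n + (m + 1)) (gammaSum n (m + 1)) x
      = (2 * n + 2 * m + 3) * quarterSum (n + m) (gammaSum n m) x
        + x * deriv (quarterSum (n + m) (gammaSum n m)) x := by
  have h := quarterSum_first_order (n + m) (gammaSum n m)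
    (fun p => gammaSum (n + 1) m p + gammaSum n (m + 1) p)
    (gammaSum_eq_zero (by omega) (by omega))
    (by simp only [gammaSum_zero_right]; norm_num) (gammaSum_succ_add n m) x
  rw [quarterSum_add] at h
  rw [show n + 1 + m = n + m + 1 by ring, ← add_assoc, h]
  push_cast
  ring

theorem cauchyConv_zero_left (m : ℕ) :
    cauchyConv 0 m = fun x => Real.pi / 2 * quarterSum (0 + m) (gammaSum 0 m) x := by
  have h00 : cauchyConv 0 0 = fun x => Real.pi / 2 * quarterSum (0 + 0) (gammaSum 0 0) x := by
    funext x
    rw [cauchyConv_zero_zero]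
    simp [quarterSum, gammaSum_zero_right, quarterPow, div_eq_mul_inv]
  induction m using Nat.twoStepInduction with
  | zero => exact h00
  | one =>
    funext x
    have h1 := cauchyConv_succ_add 0 0 x
    have h2 := quarterSum_gammaSum_succ_add 0 0 x
    rw [zero_add, cauchyConv_comm 1 0, h00, deriv_const_mul_field] at h1
    -- `gammaSum` is not visibly symmetric in n and m, so the symmetry is checked by values here.
    have hs : quarterSum (0 + 1 + 0) (gammaSum (0 + 1) 0) x =
        quarterSum (0 + (0 + 1)) (gammaSum 0 (0 + 1)) x := by
      have g01 : gammaSum 0 1 1 = 1 := by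
        rw [gammaSum_zero_left_succ, pow_zero, mul_one, coeff_one_add_X_pow_real]
        simp
      have g10 := gammaSum_succ_add 0 0 0
      simp only [zero_add, g01, gammaSum_zero_right,
        gammaSum_eq_zero (n := 0) (m := 0) (p := 1) one_pos one_pos] at g10
      have g10' : gammaSum 1 0 1 = 1 := by linarith
      simp [quarterSum, Finset.Nat.antidiagonal_succ, gammaSum_zero_right, g01, g10']
    rw [hs] at h2
    linear_combination h1 / 2 - Real.pi / 4 * h2
  | more m ih0 ih1 =>
    funext x
    have h1 := (hasDerivAt_deriv_cauchyConv 0 m x).deriv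
    have h2 := quarterSum_second_order m (gammaSum 0 m) (gammaSum 0 (m + 1)) (gammaSum 0 (m + 2))
      (by simp only [gammaSum_zero_right]) (fun p hp => gammaSum_eq_zero (by omega) hp)
      (gammaSum_zero_left_recurrence m) x
    rw [ih0, ih1] at h1
    simp only [zero_add] at h1 ⊢
    have h3 : deriv (deriv fun x => Real.pi / 2 * quarterSum m (gammaSum 0 m) x) x =
        Real.pi / 2 * deriv (deriv (quarterSum m (gammaSum 0 m))) x := by
      rw [show (deriv fun x => Real.pi / 2 * quarterSum m (gammaSum 0 m) x) =
        fun x => Real.pi / 2 * deriv (quarterSum m (gammaSum 0 m)) x from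
          funext fun x => deriv_const_mul_field _, deriv_const_mul_field]
    rw [h3] at h1
    rw [h2]
    linear_combination h1

theorem cauchyConv_eq (n m : ℕ) :
    cauchyConv n m = fun x => Real.pi / 2 * quarterSum (n + m) (gammaSum n m) x := by
  induction n generalizing m with
  | zero => exact cauchyConv_zero_left m
  | succ n ih =>
    funext x
    have h1 := cauchyConv_succ_add n m x
    have h2 := quarterSum_gammaSum_succ_add n m x
    rw [ih m, ih (m + 1), deriv_const_mul_field] at h1
    linear_combination h1 - Real.pi / 2 * h2

theorem quarterSum_gammaSum (n m : ℕ) (x : ℝ) :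
    quarterSum (n + m) (gammaSum n m) x =
      ∑ k ∈ Finset.Icc (min m n) (m + n), gammaCoeff n m k / (1 + x ^ 2 / 4) ^ (k + 1) := by
  have hsub : Finset.Icc (min m n) (m + n) ⊆ Finset.range (n + m + 1) := by
    intro k hk
    simp only [Finset.mem_Icc, Finset.mem_range] at hk ⊢
    omega
  rw [quarterSum, Finset.Nat.sum_antidiagonal_eq_sum_range_succ_mk]
  rw [← Finset.sum_subset hsub]
  · refine Finset.sum_congr rfl fun k hk => ?_
    rw [Finset.mem_Icc] at hk
    rw [gammaCoeff_of_add_eq (show k + (n + m - k) = n + m by omega), quarterPow, div_eq_mul_inv _ (_ ^ _)]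
  -- For k < min(m,n), p = n+m-k exceeds both n and m, so the term vanishes.
  · intro k hk hk'
    simp only [Finset.mem_Icc, Finset.mem_range, not_and, not_le] at hk hk'
    rw [gammaSum_eq_zero (by omega) (by omega), mul_zero, zero_mul]

theorem mainTheorem5 (n m : ℕ) (hn : 0 < n) (hm : 0 < m) (x : ℝ) :
    MeasureTheory.Integrable
      (fun y : ℝ => ((n.factorial : ℝ) * (m.factorial : ℝ) * 2 ^ (n + m)) /
        ((1 + y ^ 2) ^ (n + 1) * (1 + (x - y) ^ 2) ^ (m + 1))) MeasureTheory.volume ∧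
    ∫ y : ℝ, ((n.factorial : ℝ) * (m.factorial : ℝ) * 2 ^ (n + m)) /
        ((1 + y ^ 2) ^ (n + 1) * (1 + (x - y) ^ 2) ^ (m + 1)) =
      Real.pi / 2 *
        ∑ k ∈ Finset.Icc (min m n) (m + n), gammaCoeff n m k / (1 + x ^ 2 / 4) ^ (k + 1) := by
  have e : (fun y : ℝ => ((n.factorial : ℝ) * (m.factorial : ℝ) * 2 ^ (n + m)) /
      ((1 + y ^ 2) ^ (n + 1) * (1 + (x - y) ^ 2) ^ (m + 1))) =
      fun y => cauchyPow n y * cauchyPow m (x - y) := by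
    funext y
    rw [cauchyPow, cauchyPow, div_mul_div_comm, pow_add]
    congr 1
    ring
  rw [e, ← quarterSum_gammaSum]
  exact ⟨integrable_cauchyPow_mul n m x, congrFun (cauchyConv_eq n m) x⟩
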